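/- Let $H$ be a real Hilbert space and let $E : H\to\mathbb R\cup\{+\infty\}$ be proper (its effective domain $\operatorname{dom}E=\{E<+\infty\}$ is nonempty), lower semicontinuous and semiconvex (for some $c\in\mathbb R$ the function $v\mapsto E(v)+\frac c2\|v\|^2$ is convex). Let $\tau_E$ be the coarsest topology on $\operatorname{dom}E$ for which both the inclusion $\operatorname{dom}E\to H$ and $E:\operatorname{dom}E\to\mathbb R$ are continuous; thus $u_\alpha\to v$ in $\tau_E$ if and only if $\|u_\alpha-v\|\to0$ and $E(u_\alpha)\to E(v)$. For a function $F:H\to\mathbb R\cup\{+\infty\}$ and $v\in H$, let $\partial F(v)$ be the set of all $f\in H$ such that $F(v)<+\infty$ and $\liminf_{\lambda\to0+}\frac{F(v+\lambda w)-F(v)}{\lambda}\ge\langle f,w\rangle$ for every $w\in H$, and let $|\partial F(v)|=\inf\{\|f\|:f\in\partial F(v)\}\in[0,\infty]$, where $\inf\emptyset=\infty$. Say that $E$ satisfies the Kurdyka–Łojasiewicz–Simon inequality on a set $U\subseteq H$ if there is a strictly increasing function $\Theta\in W^{1,1}_{\mathrm{loc}}(\mathbb R)$ such that $|\partial(\Theta\circ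 E)(v)|\ge1$ for every $v\in U$ with $0\notin\partial E(v)$, where $\Theta(+\infty)=+\infty$. Let $u\in H^1_{\mathrm{loc}}([0,\infty);H)$ (continuous representative; $u$ and its weak derivative $\dot u$ are square integrable on $(0,T)$ for every $T>0$) be a global strong solution of $\dot u+\partial E(u)\ni0$, that is, $-\dot u(t)\in\partial E(u(t))$ for almost every $t>0$. Let $\omega(u)$ be the set of all $\varphi\in H$ for which there are $t_n\ge0$ with $t_n\nearrow\infty$ and $\|u(t_n)-\varphi\|\to0$. Suppose that some $\varphi\in\omega(u)$ has a $\tau_E$-neighbourhood $U\subseteq\operatorname{dom}E$ (so $\varphi\in\operatorname{dom}E$) on which $E$ satisfies the Kurdyka–Łojasiewicz–Simon inequality. Then the curve $u:[0,\infty)\to H$ has finite length, $u(t)\in\operatorname{dom}E$ for every $t\ge0$, and $u(t)\to\varphi$ in $\tau_E$ as $t\to\infty$, that is, $\|u(t)-\varphi\|\to0$ and $E(u(t))\to E(\varphi)$. -/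

import Mathlib

open MeasureTheory Filter Set
open scoped Topology ENNReal NNReal ContDiff

noncomputable section

namespace GradSys

variable {H : Type*} [NormedAddCommGroup H] [InnerProductSpace ℝ H]

/-- `E : H → ℝ ∪ {+∞}` is proper: it never takes the value `-∞`, and its effective domain
`{E < +∞}` is nonempty. -/
def Proper (E : H → EReal) : Prop :=
  (∀ v, E v ≠ ⊥) ∧ ∃ v, E v < ⊤

/-- Convexity of an extended-real-valued function (`0 * ⊤ = 0` in `EReal`, so the endpoints
`a = 0` and `b = 0` are harmless). -/
def ConvexFun (F : H → EReal) : Prop :=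
  ∀ x y : H, ∀ a b : ℝ, 0 ≤ a → 0 ≤ b → a + b = 1 →
    F (a • x + b • y) ≤ (a : EReal) * F x + (b : EReal) * F y

/-- `E` is semiconvex: `v ↦ E v + (w / 2) ‖v‖²` is convex for some real `w`. -/
def Semiconvex (E : H → EReal) : Prop :=
  ∃ w : ℝ, ConvexFun (fun v => E v + ((w / 2 * ‖v‖ ^ 2 : ℝ) : EReal))

/-- The effective domain `dom E = {E < +∞}`, as a type of its own (so that it does not inherit the
norm topology of `H`). -/
def Dom (E : H → EReal) : Type _ := {v : H // E v < ⊤}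

/-- The inclusion `dom E → H`. -/
def Dom.incl {E : H → EReal} (v : Dom E) : H := Subtype.val v

/-- The point of `dom E` given by `v : H` with `E v < +∞`. -/
def Dom.mk {E : H → EReal} (v : H) (hv : E v < ⊤) : Dom E := Subtype.mk v hv

/-- The real-valued restriction of `E` to `dom E`. -/
def Dom.energy {E : H → EReal} (v : Dom E) : ℝ := (E v.incl).toReal

/-- The topology `τ_E`: the coarsest topology on `dom E` for which the inclusion `dom E → H` and
`E : dom E → ℝ` are continuous. -/
instance tauE (E : H → EReal) : TopologicalSpace (Dom E) :=
  TopologicalSpace.induced (Dom.incl (E := E)) inferInstance ⊓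
    TopologicalSpace.induced (Dom.energy (E := E)) inferInstance

/-- The subgradient `∂E(u)`: all `f` such that `u ∈ dom E` and, for every `v`,
`liminf_{r → 0+} (E (u + r v) - E u) / r ≥ ⟨f, v⟩`. -/
def subgradient (E : H → EReal) (u : H) : Set H :=
  {f | E u < ⊤ ∧ ∀ v : H,
    ((inner ℝ f v : ℝ) : EReal) ≤
      liminf (fun r : ℝ => (E (u + r • v) - E u) / (r : EReal)) (𝓝[>] 0)}

/-- The slope `|∂E(u)| = inf {‖f‖ : f ∈ ∂E(u)} ∈ [0, ∞]`, with `inf ∅ = ∞`. -/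
def slope (E : H → EReal) (u : H) : ℝ≥0∞ :=
  ⨅ f ∈ subgradient E u, ‖f‖ₑ

/-- The composition `Θ ∘ E : H → ℝ ∪ {+∞}`, with `Θ (+∞) = +∞`. -/
def compEnergy (Θ : ℝ → ℝ) (E : H → EReal) (v : H) : EReal :=
  open Classical in if E v = ⊤ then ⊤ else ((Θ (E v).toReal : ℝ) : EReal)

/-- `g` is a weak derivative of `u` on the open set `Ω ⊆ ℝ`: both are locally integrable on `Ω`,
and `∫ ψ' u = - ∫ ψ g` for all smooth real `ψ` with compact support in `Ω`. -/
def HasWeakDerivOn {F : Type*} [NormedAddCommGroup F] [NormedSpace ℝ F]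
    (Ω : Set ℝ) (u g : ℝ → F) : Prop :=
  LocallyIntegrableOn u Ω ∧ LocallyIntegrableOn g Ω ∧
    ∀ ψ : ℝ → ℝ, ContDiff ℝ ∞ ψ → HasCompactSupport ψ → tsupport ψ ⊆ Ω →
      ∫ t in Ω, deriv ψ t • u t = - ∫ t in Ω, ψ t • g t

/-- `Θ ∈ W^{1,1}_loc(ℝ)`. -/
def MemW11loc (Θ : ℝ → ℝ) : Prop :=
  ∃ θ : ℝ → ℝ, HasWeakDerivOn univ Θ θ

/-- `E` satisfies the Kurdyka–Łojasiewicz–Simon inequality on `U`. -/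
def KLS (E : H → EReal) (U : Set H) : Prop :=
  ∃ Θ : ℝ → ℝ, StrictMono Θ ∧ MemW11loc Θ ∧
    ∀ v ∈ U, (0 : H) ∉ subgradient E v → 1 ≤ slope (compEnergy Θ E) v

/-- `u ∈ L²_loc([0, ∞); H)`: square integrable on `(0, T)` for every `T`. -/
def MemL2loc (u : ℝ → H) : Prop :=
  ∀ T : ℝ, 0 < T → MemLp u 2 (volume.restrict (Ioo 0 T))

/-- `u` (of which only the values on `[0, ∞)` matter) is a global strong solution of
`u' + ∂E(u) ∋ 0`: it belongs to `H¹_loc([0, ∞); H)`, i.e. `u` and its weak derivative `g` are in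
`L²_loc([0, ∞); H)`, it is the continuous representative, and `-g(t) ∈ ∂E(u(t))` for almost every
`t > 0`. -/
def IsGlobalStrongSolution (E : H → EReal) (u : ℝ → H) : Prop :=
  ContinuousOn u (Ici 0) ∧ MemL2loc u ∧
    ∃ g : ℝ → H, MemL2loc g ∧ HasWeakDerivOn (Ioi 0) u g ∧
      ∀ᵐ t ∂(volume.restrict (Ioi (0 : ℝ))), -g t ∈ subgradient E (u t)

/-- The `ω`-limit set of `u : [0, ∞) → H`, with respect to the norm topology of `H`. -/
def omegaLimitSet (u : ℝ → H) : Set H :=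
  {φ | ∃ t : ℕ → ℝ, (∀ n, 0 ≤ t n) ∧ Monotone t ∧ Tendsto t atTop atTop ∧
    Tendsto (fun n => u (t n)) atTop (𝓝 φ)}

/-- `u : [0, ∞) → H` has finite length: the supremum of the lengths of inscribed polygons is
finite. -/
def HasFiniteLength (u : ℝ → H) : Prop :=
  eVariationOn u (Ici 0) < ⊤

end GradSys

end

/-!
A Łojasiewicz argument: as long as `u` stays where the Kurdyka–Łojasiewicz–Simon inequality holds,
`‖u'‖ ≤ -(Θ ∘ E ∘ u)'`, so the length of `u` is at most the drop of `Θ (E (u t))`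
(`IsGradientCurve.integral_norm_le`). At a late time `u` is close to `φ` and `E (u t)` is close to
`E φ`, so the length still to come is too small for `u` to leave the neighbourhood
(`IsGradientCurve.exists_forall_norm_sub_lt`).

The analytic input is the chain rule for `E (u t)`, which is obtained without Moreau–Yosida
regularization and without proving `E (u t)` absolutely continuous. Semiconvexity turns the
subgradient into a global inequality with a quadratic error
(`toReal_add_inner_le_of_mem_subgradient`), and this makes the energy decreasing
(`IsGradientCurve.energy_antitone`) and finite up to `t = 0` (`IsGradientCurve.energy_lt_top`). A
monotone function is differentiable almost everywhere and its derivative integrates to at most its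
increment; at a common point of differentiability of `u` and of the energy, the subgradient
inequality identifies the derivative as `-‖u' t‖²` (`IsGradientCurve.deriv_energyAlong`). The
inequality for the integral is all that the argument uses. The same holds for `Θ ∘ E ∘ u`: the
exceptional set, where `E (u t)` is a point of nondifferentiability of `Θ`, is harmless because a
monotone function has zero derivative almost everywhere on the preimage of a null set
(`ae_deriv_eq_zero_of_antitone`). The condition `Θ ∈ W^{1,1}_loc` enters through the continuity of
`Θ` only.

That the energy tends to `E φ`, and not only to a limit at least `E φ`, follows from the
integrability of `‖u'‖²`: at suitable late times the subgradient is small, and the subgradient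
inequality compares with `E φ` (`IsGradientCurve.exists_energyAlong_lt`).
-/

namespace GradSys

/-! ### Weak derivatives in one variable -/

/-- The smooth step from `0` to `1` that rises on `[p, p + η]`. -/
noncomputable def smoothStep (p η x : ℝ) : ℝ := Real.smoothTransition ((x - p) / η)

section SmoothStep

variable {p η : ℝ}

lemma contDiff_smoothStep (p η : ℝ) : ContDiff ℝ ∞ (smoothStep p η) := by
  unfold smoothStep
  exact Real.smoothTransition.contDiff.comp ((contDiff_id.sub contDiff_const).div_const η)

lemma smoothStep_eq_zero (hη : 0 < η) {x : ℝ} (hx : x ≤ p) : smoothStep p η x = 0 :=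
  Real.smoothTransition.zero_of_nonpos (div_nonpos_of_nonpos_of_nonneg (by linarith) hη.le)

lemma smoothStep_eq_one (hη : 0 < η) {x : ℝ} (hx : p + η ≤ x) : smoothStep p η x = 1 :=
  Real.smoothTransition.one_of_one_le ((one_le_div hη).2 (by linarith))

lemma monotone_smoothStep (hη : 0 < η) : Monotone (smoothStep p η) := fun x y hxy =>
  Real.smoothTransition.monotone (by gcongr)

lemma continuous_deriv_smoothStep (p η : ℝ) : Continuous (deriv (smoothStep p η)) :=
  (contDiff_smoothStep p η).continuous_deriv (by simp)

lemma deriv_smoothStep_nonneg (hη : 0 < η) (x : ℝ) : 0 ≤ deriv (smoothStep p η) x :=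
  (monotone_smoothStep hη).deriv_nonneg

lemma deriv_smoothStep_eq_zero (hη : 0 < η) {x : ℝ} (hx : x ∉ Ioc p (p + η)) :
    deriv (smoothStep p η) x = 0 := by
  -- Off `(p, p + η]` the step attains its minimum `0` or its maximum `1`.
  rcases le_or_gt x p with h | h
  · refine IsLocalMin.deriv_eq_zero (Eventually.of_forall fun y => ?_)
    rw [smoothStep_eq_zero hη h]
    exact Real.smoothTransition.nonneg _
  · have h' : p + η ≤ x := by
      by_contra! hh
      exact hx ⟨h, hh.le⟩
    refine IsLocalMax.deriv_eq_zero (Eventually.of_forall fun y => ?_)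
    rw [smoothStep_eq_one hη h']
    exact Real.smoothTransition.le_one _

lemma integral_deriv_smoothStep (hη : 0 < η) :
    ∫ x in p..p + η, deriv (smoothStep p η) x = 1 := by
  rw [intervalIntegral.integral_deriv_eq_sub
    (fun x _ => ((contDiff_smoothStep p η).differentiable (by simp)).differentiableAt)
    ((continuous_deriv_smoothStep p η).intervalIntegrable _ _),
    smoothStep_eq_one hη le_rfl, smoothStep_eq_zero hη le_rfl, sub_zero]

end SmoothStep

section WeakDerivative

variable {F : Type*} [NormedAddCommGroup F] [NormedSpace ℝ F]

lemma setIntegral_eq_intervalIntegral_of_support {Ω : Set ℝ} (hΩ : MeasurableSet Ω) {f : ℝ → F}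
    {a b : ℝ} (hab : a ≤ b) (hI : Icc a b ⊆ Ω) (hf : ∀ x ∉ Ioc a b, f x = 0) :
    ∫ x in Ω, f x = ∫ x in a..b, f x := by
  rw [intervalIntegral.integral_of_le hab]
  exact setIntegral_eq_of_subset_of_forall_sdiff_eq_zero hΩ (Ioc_subset_Icc_self.trans hI)
    fun x hx => hf x hx.2

/-- The derivative of a smooth step is an approximate identity: it has mass one and lives on
`[p, p + η]`. -/
lemma norm_integral_deriv_smoothStep_sub_le [CompleteSpace F] {Ω : Set ℝ}
    (hΩ : MeasurableSet Ω) {u : ℝ → F} (hu : LocallyIntegrableOn u Ω) {p η ε : ℝ} (hη : 0 < η)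
    (hI : Icc p (p + η) ⊆ Ω) (v : F)
    (hv : ∀ x ∈ Icc p (p + η), ‖u x - v‖ ≤ ε) :
    ‖(∫ x in Ω, deriv (smoothStep p η) x • u x) - v‖ ≤ ε := by
  have hle : p ≤ p + η := by linarith
  have hk := continuous_deriv_smoothStep p η
  have hui : IntervalIntegrable u volume p (p + η) := by
    rw [intervalIntegrable_iff_integrableOn_Icc_of_le hle]
    exact hu.integrableOn_compact_subset hI isCompact_Icc
  have hki : IntervalIntegrable (deriv (smoothStep p η)) volume p (p + η) :=
    hk.intervalIntegrable _ _
  have h1 : IntervalIntegrable (fun x => deriv (smoothStep p η) x • u x) volume p (p + η) :=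
    hui.continuousOn_smul hk.continuousOn
  have h2 : IntervalIntegrable (fun x => deriv (smoothStep p η) x • v) volume p (p + η) :=
    (hk.smul continuous_const).intervalIntegrable _ _
  have hv' : v = ∫ x in p..p + η, deriv (smoothStep p η) x • v := by
    rw [intervalIntegral.integral_smul_const, integral_deriv_smoothStep hη, one_smul]
  rw [setIntegral_eq_intervalIntegral_of_support hΩ hle hI
    (fun x hx => by rw [deriv_smoothStep_eq_zero hη hx, zero_smul])]
  nth_rewrite 1 [hv']
  rw [← intervalIntegral.integral_sub h1 h2]
  calc _ ≤ ∫ x in p..p + η, deriv (smoothStep p η) x * ε := by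
        refine intervalIntegral.norm_integral_le_of_norm_le hle ?_ (hki.mul_const ε)
        refine Eventually.of_forall fun x hx => ?_
        rw [← smul_sub, norm_smul, Real.norm_of_nonneg (deriv_smoothStep_nonneg hη x)]
        exact mul_le_mul_of_nonneg_left (hv x (Ioc_subset_Icc_self hx))
          (deriv_smoothStep_nonneg hη x)
    _ = ε := by rw [intervalIntegral.integral_mul_const, integral_deriv_smoothStep hη, one_mul]

/-- The fundamental theorem of calculus for a weak derivative, at points of continuity. It follows
by testing with smooth approximations of the indicator function of `[s, t]`. -/
lemma HasWeakDerivOn.integral_eq_sub [CompleteSpace F] {Ω : Set ℝ}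
    (hΩ : MeasurableSet Ω) {u g : ℝ → F} (h : HasWeakDerivOn Ω u g) {s t : ℝ} (hst : s < t)
    (hI : Icc s t ⊆ Ω)
    (hs : ContinuousAt u s) (ht : ContinuousAt u t) : ∫ x in s..t, g x = u t - u s := by
  obtain ⟨hu, hg, hw⟩ := h
  set ψ : ℝ → ℝ → ℝ := fun η x => smoothStep s η x - smoothStep (t - η) η x with hψ
  have hψd : ∀ η, ContDiff ℝ ∞ (ψ η) := fun η =>
    (contDiff_smoothStep s η).sub (contDiff_smoothStep (t - η) η)
  have hev : ∀ᶠ η : ℝ in 𝓝[>] 0, 0 < η ∧ η < t - s := by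
    filter_upwards [self_mem_nhdsWithin, nhdsWithin_le_nhds (Iio_mem_nhds (sub_pos.2 hst))]
      with η h1 h2 using ⟨h1, h2⟩
  have hsupp : ∀ η, 0 < η → η < t - s → ∀ x ∉ Ioc s t, ψ η x = 0 := by
    intro η h1 h2 x hx
    rcases le_or_gt x s with hxs | hxs
    · simp [hψ, smoothStep_eq_zero h1 hxs, smoothStep_eq_zero h1 (show x ≤ t - η by linarith)]
    · have hxt : t < x := by
        by_contra! hh
        exact hx ⟨hxs, hh⟩
      simp [hψ, smoothStep_eq_one h1 (show s + η ≤ x by linarith),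
        smoothStep_eq_one h1 (show t - η + η ≤ x by linarith)]
  have hgi : IntervalIntegrable g volume s t := by
    rw [intervalIntegrable_iff_integrableOn_Icc_of_le hst.le]
    exact hg.integrableOn_compact_subset hI isCompact_Icc
  -- The test function converges to the indicator function of `(s, t)`.
  have hR : Tendsto (fun η => ∫ x in Ω, ψ η x • g x) (𝓝[>] 0) (𝓝 (∫ x in s..t, g x)) := by
    have hlim : Tendsto (fun η => ∫ x in s..t, ψ η x • g x) (𝓝[>] 0)
        (𝓝 (∫ x in s..t, g x)) := by
      refine intervalIntegral.tendsto_integral_filter_of_dominated_convergence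
        (fun x => ‖g x‖) ?_ ?_ hgi.norm ?_
      · refine Eventually.of_forall fun η => ?_
        exact ((hψd η).continuous.aestronglyMeasurable).smul
          hgi.aestronglyMeasurable_restrict_uIoc
      · filter_upwards [hev] with η hη
        refine Eventually.of_forall fun x _ => ?_
        rw [norm_smul]
        refine mul_le_of_le_one_left (norm_nonneg _) ?_
        rw [Real.norm_eq_abs, abs_le]
        have a1 := Real.smoothTransition.nonneg ((x - s) / η)
        have a2 := Real.smoothTransition.le_one ((x - s) / η)
        have a3 := Real.smoothTransition.nonneg ((x - (t - η)) / η)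
        have a4 := Real.smoothTransition.le_one ((x - (t - η)) / η)
        simp only [hψ, smoothStep]
        constructor <;> linarith
      · have hne : ∀ᵐ x : ℝ, x ≠ t := by simp [ae_iff, measure_singleton]
        filter_upwards [hne] with x hxt hx
        rw [uIoc_of_le hst.le] at hx
        have hxt' : x < t := lt_of_le_of_ne hx.2 hxt
        refine tendsto_const_nhds.congr' ?_
        filter_upwards [hev, nhdsWithin_le_nhds (Iio_mem_nhds (sub_pos.2 hx.1)),
          nhdsWithin_le_nhds (Iio_mem_nhds (sub_pos.2 hxt'))] with η h0 h1 h2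
        rw [mem_Iio] at h1 h2
        simp [hψ, smoothStep_eq_one h0.1 (show s + η ≤ x by linarith),
          smoothStep_eq_zero h0.1 (show x ≤ t - η by linarith)]
    refine hlim.congr' ?_
    filter_upwards [hev] with η hη
    exact (setIntegral_eq_intervalIntegral_of_support hΩ hst.le hI
      (fun x hx => by rw [hsupp η hη.1 hη.2 x hx, zero_smul])).symm
  -- Its derivative converges to the difference of the Dirac masses at `s` and at `t`.
  have hA : Tendsto (fun η => ∫ x in Ω, deriv (smoothStep s η) x • u x) (𝓝[>] 0) (𝓝 (u s)) := by
    rw [Metric.tendsto_nhds]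
    intro ε hε
    obtain ⟨δ, hδ, hδu⟩ := Metric.continuousAt_iff.1 hs (ε / 2) (half_pos hε)
    filter_upwards [hev, nhdsWithin_le_nhds (Iio_mem_nhds hδ)] with η h0 h1
    rw [mem_Iio] at h1
    rw [dist_eq_norm]
    refine (norm_integral_deriv_smoothStep_sub_le hΩ hu h0.1
      ((Icc_subset_Icc le_rfl (by linarith)).trans hI) (u s) fun x hx => ?_).trans_lt
      (half_lt_self hε)
    rw [← dist_eq_norm]
    refine (hδu ?_).le
    rw [Real.dist_eq, abs_lt]
    constructor <;> linarith [hx.1, hx.2]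
  have hB : Tendsto (fun η => ∫ x in Ω, deriv (smoothStep (t - η) η) x • u x) (𝓝[>] 0)
      (𝓝 (u t)) := by
    rw [Metric.tendsto_nhds]
    intro ε hε
    obtain ⟨δ, hδ, hδu⟩ := Metric.continuousAt_iff.1 ht (ε / 2) (half_pos hε)
    filter_upwards [hev, nhdsWithin_le_nhds (Iio_mem_nhds hδ)] with η h0 h1
    rw [mem_Iio] at h1
    rw [dist_eq_norm]
    refine (norm_integral_deriv_smoothStep_sub_le hΩ hu h0.1
      ((Icc_subset_Icc (by linarith) (by linarith)).trans hI) (u t) fun x hx => ?_).trans_lt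
      (half_lt_self hε)
    rw [← dist_eq_norm]
    refine (hδu ?_).le
    rw [Real.dist_eq, abs_lt]
    constructor <;> linarith [hx.1, hx.2]
  have hint : ∀ p η : ℝ, 0 < η → s ≤ p → p + η ≤ t →
      IntegrableOn (fun x => deriv (smoothStep p η) x • u x) Ω := by
    intro p η hη hp hpt
    have hsub : Icc p (p + η) ⊆ Ω := (Icc_subset_Icc hp hpt).trans hI
    have h1 : IntegrableOn (fun x => deriv (smoothStep p η) x • u x) (Icc p (p + η)) :=
      (hu.integrableOn_compact_subset hsub isCompact_Icc).continuousOn_smul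
        (continuous_deriv_smoothStep p η).continuousOn isCompact_Icc
    refine IntegrableOn.of_forall_sdiff_eq_zero h1 hΩ fun x hx => ?_
    rw [deriv_smoothStep_eq_zero hη fun h' => hx.2 (Ioc_subset_Icc_self h'), zero_smul]
  have hL : Tendsto (fun η => ∫ x in Ω, deriv (ψ η) x • u x) (𝓝[>] 0) (𝓝 (u s - u t)) := by
    refine (hA.sub hB).congr' ?_
    filter_upwards [hev] with η hη
    rw [← integral_sub (hint s η hη.1 le_rfl (by linarith))
      (hint (t - η) η hη.1 (by linarith) (by linarith))]
    refine integral_congr_ae (Eventually.of_forall fun x => ?_)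
    have hd : deriv (ψ η) x = deriv (smoothStep s η) x - deriv (smoothStep (t - η) η) x :=
      deriv_fun_sub ((contDiff_smoothStep s η).differentiable (by simp)).differentiableAt
        ((contDiff_smoothStep (t - η) η).differentiable (by simp)).differentiableAt
    simp only [hd, sub_smul]
  have heq : (fun η => ∫ x in Ω, deriv (ψ η) x • u x) =ᶠ[𝓝[>] 0]
      fun η => -∫ x in Ω, ψ η x • g x := by
    filter_upwards [hev] with η hη
    have hts : tsupport (ψ η) ⊆ Icc s t := by
      refine closure_minimal (fun x hx => ?_) isClosed_Icc
      by_contra hh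
      exact hx (hsupp η hη.1 hη.2 x fun h' => hh (Ioc_subset_Icc_self h'))
    exact hw (ψ η) (hψd η) (HasCompactSupport.of_support_subset_isCompact isCompact_Icc
      ((subset_tsupport _).trans hts)) (hts.trans hI)
  have := tendsto_nhds_unique (hL.congr' heq) hR.neg
  rw [← neg_sub, this, neg_neg]

end WeakDerivative

/-- The increment of `Θ` between two points of continuity is the integral of its weak derivative,
so `Θ` has no jumps. -/
lemma continuous_of_monotone_of_memW11loc {Θ : ℝ → ℝ} (hmono : Monotone Θ)
    (hΘ : MemW11loc Θ) : Continuous Θ := by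
  obtain ⟨θ, hθ⟩ := hΘ
  have hint : ∀ a b, IntervalIntegrable θ volume a b := fun a b =>
    ((locallyIntegrableOn_univ.1 hθ.2.1).integrableOn_isCompact isCompact_uIcc).intervalIntegrable
  have hdense : Dense {x | ContinuousAt Θ x} := by
    have := hmono.countable_not_continuousAt.dense_compl ℝ
    simpa [compl_ofPred] using this
  rw [continuous_iff_continuousAt]
  intro p
  rw [Metric.continuousAt_iff]
  intro ε hε
  obtain ⟨δ, hδ, hP⟩ := Metric.continuousAt_iff.1
    ((intervalIntegral.continuous_primitive hint p).continuousAt (x := p)) (ε / 2) (half_pos hε)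
  obtain ⟨s, hs, hs1, hs2⟩ := hdense.exists_between (show p - δ < p by linarith)
  obtain ⟨t, ht, ht1, ht2⟩ := hdense.exists_between (show p < p + δ by linarith)
  have key := hθ.integral_eq_sub MeasurableSet.univ (hs2.trans ht1) (subset_univ _) hs ht
  have h1 := hP (x := s) (by rw [Real.dist_eq, abs_lt]; constructor <;> linarith)
  have h2 := hP (x := t) (by rw [Real.dist_eq, abs_lt]; constructor <;> linarith)
  rw [intervalIntegral.integral_same, Real.dist_eq, sub_zero, abs_lt] at h1 h2
  rw [← intervalIntegral.integral_interval_sub_left (hint p t) (hint p s)] at key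
  refine ⟨min (p - s) (t - p), lt_min (by linarith) (by linarith), fun {x} hx => ?_⟩
  rw [Real.dist_eq, abs_lt, lt_min_iff] at *
  have a1 := hmono (show s ≤ x by have := min_le_left (p - s) (t - p); linarith)
  have a2 := hmono (show x ≤ t by have := min_le_right (p - s) (t - p); linarith)
  have a3 := hmono hs2.le
  have a4 := hmono ht1.le
  constructor <;> linarith

/-! ### Subgradients of semiconvex functions and of `Θ ∘ E` -/

section Subgradient

variable {H : Type*} [NormedAddCommGroup H] [InnerProductSpace ℝ H] {E : H → EReal}

/-- The subgradient of a semiconvex function satisfies a global inequality: the directional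
`liminf` is bounded by the difference quotient over the whole segment. -/
lemma toReal_add_inner_le_of_mem_subgradient (hbot : ∀ v, E v ≠ ⊥) {C : ℝ}
    (hC : ConvexFun fun v => E v + ((C / 2 * ‖v‖ ^ 2 : ℝ) : EReal)) {v w f : H}
    (hf : f ∈ subgradient E v) (hw : E w < ⊤) :
    (E v).toReal + inner ℝ f (w - v) - C / 2 * ‖w - v‖ ^ 2 ≤ (E w).toReal := by
  obtain ⟨hv, hf⟩ := hf
  have ha : E v = ((E v).toReal : EReal) := (EReal.coe_toReal hv.ne (hbot v)).symm
  have hb : E w = ((E w).toReal : EReal) := (EReal.coe_toReal hw.ne (hbot w)).symm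
  set a := (E v).toReal
  set b := (E w).toReal
  have hquot : ∀ᶠ r : ℝ in 𝓝[>] 0, (E (v + r • (w - v)) - E v) / (r : EReal) ≤
      ((b - a + C / 2 * (1 - r) * ‖w - v‖ ^ 2 : ℝ) : EReal) := by
    filter_upwards [self_mem_nhdsWithin, nhdsWithin_le_nhds (Iio_mem_nhds one_pos)] with r hr hr1
    rw [mem_Ioi] at hr
    rw [mem_Iio] at hr1
    have h := hC v w (1 - r) r (by linarith) hr.le (by ring)
    have hvr : (1 - r) • v + r • w = v + r • (w - v) := by
      rw [sub_smul, one_smul, smul_sub]; abel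
    have hnorm : ‖v + r • (w - v)‖ ^ 2 =
        (1 - r) * ‖v‖ ^ 2 + r * ‖w‖ ^ 2 - r * (1 - r) * ‖w - v‖ ^ 2 := by
      rw [norm_add_sq_real, norm_sub_sq_real, norm_smul, inner_smul_right, inner_sub_right,
        real_inner_self_eq_norm_sq, mul_pow, norm_sub_sq_real, Real.norm_eq_abs, sq_abs,
        real_inner_comm]
      ring
    simp only [hvr] at h
    set z := v + r • (w - v)
    rw [ha, hb] at h
    have hz : E z < ⊤ := by
      by_contra hh
      rw [not_lt_top_iff] at hh
      rw [hh, EReal.top_add_coe] at h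
      have : (⊤ : EReal) ≤ (((1 - r) * (a + C / 2 * ‖v‖ ^ 2) +
        r * (b + C / 2 * ‖w‖ ^ 2) : ℝ) : EReal) := by exact_mod_cast h
      exact EReal.coe_ne_top _ (top_le_iff.1 this)
    have hx : E z = ((E z).toReal : EReal) := (EReal.coe_toReal hz.ne (hbot z)).symm
    set x := (E z).toReal
    rw [hx] at h
    have h' : x + C / 2 * ‖z‖ ^ 2 ≤ (1 - r) * (a + C / 2 * ‖v‖ ^ 2) +
        r * (b + C / 2 * ‖w‖ ^ 2) := by exact_mod_cast h
    rw [hx, ha, ← EReal.coe_sub, ← EReal.coe_div, EReal.coe_le_coe_iff, div_le_iff₀ hr]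
    rw [hnorm] at h'
    linarith
  have hlim : Tendsto (fun r : ℝ => ((b - a + C / 2 * (1 - r) * ‖w - v‖ ^ 2 : ℝ) : EReal))
      (𝓝[>] 0) (𝓝 ((b - a + C / 2 * (1 - 0) * ‖w - v‖ ^ 2 : ℝ) : EReal)) := by
    refine (continuous_coe_real_ereal.tendsto _).comp (Tendsto.mono_left ?_ nhdsWithin_le_nhds)
    exact Continuous.tendsto (f := fun r : ℝ => b - a + C / 2 * (1 - r) * ‖w - v‖ ^ 2)
      (by fun_prop) 0
  have := ((hf (w - v)).trans (liminf_le_liminf hquot)).trans hlim.liminf_eq.le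
  rw [EReal.coe_le_coe_iff] at this
  linarith

lemma smul_mem_subgradient_compEnergy (hbot : ∀ v, E v ≠ ⊥) {Θ : ℝ → ℝ} (hΘ : Monotone Θ)
    {v f : H} (hf : f ∈ subgradient E v) {d : ℝ} (hd : HasDerivAt Θ d (E v).toReal) :
    d • f ∈ subgradient (compEnergy Θ E) v := by
  obtain ⟨hv, hf⟩ := hf
  have ha : E v = ((E v).toReal : EReal) := (EReal.coe_toReal hv.ne (hbot v)).symm
  have hcv : compEnergy Θ E v = ((Θ (E v).toReal : ℝ) : EReal) := by
    simp [compEnergy, hv.ne]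
  set a := (E v).toReal
  have hd0 : 0 ≤ d := hd.deriv ▸ hΘ.deriv_nonneg
  refine ⟨by rw [hcv]; exact EReal.coe_lt_top _, fun w => ?_⟩
  rw [inner_smul_left]
  refine EReal.ge_of_forall_gt_iff_ge.1 fun m hm => ?_
  rw [EReal.coe_lt_coe_iff] at hm
  simp only [conj_trivial] at hm
  obtain ⟨k, hk, hmk⟩ : ∃ k < inner ℝ f w, m < d * k := by
    have hc : Tendsto (fun k : ℝ => d * k) (𝓝[<] inner ℝ f w) (𝓝 (d * inner ℝ f w)) :=
      (Continuous.tendsto (by fun_prop) _).mono_left nhdsWithin_le_nhds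
    obtain ⟨k, h1, h2⟩ := ((hc.eventually (lt_mem_nhds hm)).and self_mem_nhdsWithin).exists
    exact ⟨k, h2, h1⟩
  have hE : ∀ᶠ r : ℝ in 𝓝[>] 0, (k : EReal) < (E (v + r • w) - E v) / (r : EReal) :=
    eventually_lt_of_lt_liminf ((EReal.coe_lt_coe_iff.2 hk).trans_le (hf w))
  have hD : ∀ᶠ r : ℝ in 𝓝[>] 0, m < (Θ (a + k * r) - Θ a) / r := by
    have h1 : HasDerivAt (fun r : ℝ => Θ (a + k * r)) (d * k) 0 := by
      have h2 : HasDerivAt (fun r : ℝ => a + k * r) k 0 := by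
        simpa using ((hasDerivAt_id (0 : ℝ)).const_mul k).const_add a
      have h3 : HasDerivAt Θ d (a + k * 0) := by simpa using hd
      exact h3.comp (0 : ℝ) h2
    have h4 := h1.tendsto_slope_zero_right.eventually (lt_mem_nhds hmk)
    filter_upwards [h4] with r hr
    simpa [div_eq_inv_mul] using hr
  refine le_liminf_of_le (by isBoundedDefault) ?_
  filter_upwards [hE, hD, self_mem_nhdsWithin] with r h1 h2 hr
  rw [mem_Ioi] at hr
  rw [hcv]
  rcases eq_or_ne (E (v + r • w)) ⊤ with htop | htop
  · simp only [compEnergy, htop, if_true]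
    rw [EReal.top_sub_coe, EReal.top_div_of_pos_ne_top (by exact_mod_cast hr) (EReal.coe_ne_top r)]
    exact le_top
  · have hx : E (v + r • w) = ((E (v + r • w)).toReal : EReal) :=
      (EReal.coe_toReal htop (hbot _)).symm
    have hcx : compEnergy Θ E (v + r • w) = ((Θ (E (v + r • w)).toReal : ℝ) : EReal) := by
      simp [compEnergy, htop]
    rw [hcx]
    set x := (E (v + r • w)).toReal
    rw [hx, ha, ← EReal.coe_sub, ← EReal.coe_div, EReal.coe_lt_coe_iff, lt_div_iff₀ hr] at h1
    rw [← EReal.coe_sub, ← EReal.coe_div, EReal.coe_le_coe_iff]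
    refine h2.le.trans ?_
    gcongr
    exact hΘ (by linarith)

/-- The slope of `Θ ∘ E` at a point where `Θ` is differentiable. -/
lemma one_le_mul_norm_of_one_le_slope (hbot : ∀ v, E v ≠ ⊥) {Θ : ℝ → ℝ} (hΘ : Monotone Θ)
    {v f : H} (hf : f ∈ subgradient E v) {d : ℝ} (hd : HasDerivAt Θ d (E v).toReal)
    (hs : 1 ≤ slope (compEnergy Θ E) v) : 1 ≤ d * ‖f‖ := by
  have hd0 : 0 ≤ d := hd.deriv ▸ hΘ.deriv_nonneg
  have h : (1 : ℝ≥0∞) ≤ ‖d • f‖ₑ :=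
    hs.trans (iInf₂_le _ (smul_mem_subgradient_compEnergy hbot hΘ hf hd))
  rw [enorm_smul, Real.enorm_of_nonneg hd0, ← ofReal_norm, ← ENNReal.ofReal_mul hd0] at h
  exact ENNReal.one_le_ofReal.1 h

end Subgradient

/-! ### Integrals and derivatives of real functions -/

lemma absolutelyContinuousOnInterval_of_dist_le {X : Type*} [PseudoMetricSpace X] {f : ℝ → X}
    {L : ℝ → ℝ} {a b K : ℝ} (hL : AbsolutelyContinuousOnInterval L a b)
    (h : ∀ x ∈ uIcc a b, ∀ y ∈ uIcc a b, dist (f x) (f y) ≤ K * dist (L x) (L y)) :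
    AbsolutelyContinuousOnInterval f a b := by
  have h0 : Tendsto (fun I : ℕ × (ℕ → ℝ × ℝ) =>
      K * ∑ i ∈ Finset.range I.1, dist (L (I.2 i).1) (L (I.2 i).2))
      (AbsolutelyContinuousOnInterval.totalLengthFilter ⊓
        𝓟 (AbsolutelyContinuousOnInterval.disjWithin a b)) (𝓝 0) := by
    simpa using Tendsto.const_mul K hL
  refine squeeze_zero' (Eventually.of_forall fun _ => Finset.sum_nonneg fun _ _ => dist_nonneg)
    ?_ h0
  filter_upwards [mem_inf_of_right (mem_principal_self _)] with I hI
  rw [Finset.mul_sum]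
  exact Finset.sum_le_sum fun i hi => h _ (hI.1 i hi).1 _ (hI.1 i hi).2

lemma sq_intervalIntegral_le {f : ℝ → ℝ} {s t : ℝ} (hst : s ≤ t)
    (hf : IntervalIntegrable f volume s t)
    (hf2 : IntervalIntegrable (fun x => f x ^ 2) volume s t) :
    (∫ x in s..t, f x) ^ 2 ≤ (t - s) * ∫ x in s..t, f x ^ 2 := by
  rcases hst.eq_or_lt with rfl | hlt
  · simp
  set I := ∫ x in s..t, f x
  set m := I / (t - s) with hm
  have h0 : 0 ≤ ∫ x in s..t, (f x - m) ^ 2 :=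
    intervalIntegral.integral_nonneg hst fun x _ => sq_nonneg _
  have h1 : ∫ x in s..t, (f x - m) ^ 2 = (∫ x in s..t, f x ^ 2) - 2 * m * I + (t - s) * m ^ 2 := by
    have : ∀ x, (f x - m) ^ 2 = f x ^ 2 - 2 * m * f x + m ^ 2 := fun x => by ring
    simp only [this]
    rw [intervalIntegral.integral_add (hf2.sub (hf.const_mul _)) (by simp),
      intervalIntegral.integral_sub hf2 (hf.const_mul _), intervalIntegral.integral_const_mul,
      intervalIntegral.integral_const, smul_eq_mul]
  have hpos : 0 < t - s := sub_pos.2 hlt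
  rw [h1] at h0
  have h2 : I = m * (t - s) := by rw [hm]; field_simp
  rw [h2] at h0 ⊢
  nlinarith

/-- An antitone function has zero derivative at almost every point of the preimage of a null set:
the integral of its derivative over a set is the measure of the image. -/
lemma ae_deriv_eq_zero_of_antitone {e : ℝ → ℝ} (he : Antitone e) {N : Set ℝ} (hN : volume N = 0) :
    ∀ᵐ t, e t ∈ N → deriv e t = 0 := by
  set N' := toMeasurable volume N
  set A : Set ℝ := {t | DifferentiableAt ℝ e t} ∩ e ⁻¹' N' with hA
  have hAm : MeasurableSet A :=
    (measurableSet_of_differentiableAt ℝ e).inter (he.measurable (measurableSet_toMeasurable _ _))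
  have hint : ∫⁻ x in A, ENNReal.ofReal (-deriv e x) = 0 := by
    rw [lintegral_deriv_eq_volume_image_of_antitoneOn hAm
      (fun x hx => hx.1.hasDerivAt.hasDerivWithinAt) (he.antitoneOn A)]
    refine measure_mono_null (t := N') ?_ (by rw [measure_toMeasurable, hN])
    rintro _ ⟨x, hx, rfl⟩
    exact hx.2
  rw [lintegral_eq_zero_iff (by fun_prop)] at hint
  have hint' := (ae_restrict_iff' hAm).1 hint
  filter_upwards [hint'] with t ht htN
  by_cases hd : DifferentiableAt ℝ e t
  · have h1 := ht ⟨hd, subset_toMeasurable _ _ htN⟩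
    have h2 : 0 ≤ deriv e t := by simpa using h1
    have h3 : 0 ≤ deriv (fun x => -e x) t := he.neg.deriv_nonneg
    rw [deriv.fun_neg] at h3
    linarith
  · exact deriv_zero_of_not_differentiableAt hd

/-- The integral of the derivative of an antitone function. -/
lemma intervalIntegral_neg_deriv_le_of_antitone {e : ℝ → ℝ} (he : Antitone e) {s t : ℝ}
    (hst : s ≤ t) : IntervalIntegrable (fun x => -deriv e x) volume s t ∧
      ∫ x in s..t, -deriv e x ≤ e s - e t := by
  have hm : MonotoneOn (fun x => -e x) (uIcc s t) := he.neg.monotoneOn _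
  have hd : deriv (fun x => -e x) = fun x => -deriv e x := by ext x; exact deriv.fun_neg
  have h1 := hm.intervalIntegrable_deriv
  have h2 := hm.intervalIntegral_deriv_mem_uIcc
  rw [hd] at h1 h2
  have h3 := he hst
  rw [uIcc_of_le (by linarith)] at h2
  exact ⟨h1, by linarith [h2.2]⟩

/-! ### Gradient curves -/

variable {H : Type*} [NormedAddCommGroup H] [InnerProductSpace ℝ H]

/-- A gradient curve of a lower semicontinuous function `E` with `E + (C / 2) ‖·‖²` convex: `u` is
the primitive of `g ∈ L²_loc([0, ∞); H)`, and `-g t ∈ ∂E(u t)` for almost every `t > 0`. The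
constant `C` is taken nonnegative, and the subgradient inequality is recorded in the global form
that semiconvexity gives it. -/
structure IsGradientCurve (E : H → EReal) (C : ℝ) (u g : ℝ → H) : Prop where
  ne_bot : ∀ v, E v ≠ ⊥
  lsc : LowerSemicontinuous E
  nonneg : 0 ≤ C
  le_toReal : ∀ v w f, f ∈ subgradient E v → E w < ⊤ →
    (E v).toReal + inner ℝ f (w - v) - C / 2 * ‖w - v‖ ^ 2 ≤ (E w).toReal
  continuousOn : ContinuousOn u (Ici 0)
  intervalIntegrable : ∀ s t, 0 ≤ s → 0 ≤ t → IntervalIntegrable g volume s t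
  intervalIntegrable_sq : ∀ s t, 0 ≤ s → 0 ≤ t →
    IntervalIntegrable (fun x => ‖g x‖ ^ 2) volume s t
  integral_eq : ∀ s t, 0 ≤ s → s ≤ t → ∫ x in s..t, g x = u t - u s
  ae_mem : ∀ᵐ t : ℝ, 0 < t → -g t ∈ subgradient E (u t)

namespace IsGradientCurve

variable {E : H → EReal} {C : ℝ} {u g : ℝ → H}

lemma norm_sub_le (hu : IsGradientCurve E C u g) {s t : ℝ} (hs : 0 ≤ s) (hst : s ≤ t) :
    ‖u t - u s‖ ≤ ∫ x in s..t, ‖g x‖ := by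
  rw [← hu.integral_eq s t hs hst]
  exact intervalIntegral.norm_integral_le_integral_norm hst

lemma norm_sub_sq_le (hu : IsGradientCurve E C u g) {s t : ℝ} (hs : 0 ≤ s) (hst : s ≤ t) :
    ‖u t - u s‖ ^ 2 ≤ (t - s) * ∫ x in s..t, ‖g x‖ ^ 2 :=
  (pow_le_pow_left₀ (norm_nonneg _) (hu.norm_sub_le hs hst) 2).trans
    (sq_intervalIntegral_le hst (hu.intervalIntegrable s t hs (hs.trans hst)).norm
      (hu.intervalIntegrable_sq s t hs (hs.trans hst)))

lemma integral_sq_sub (hu : IsGradientCurve E C u g) {a s t : ℝ} (ha : 0 ≤ a) (hs : 0 ≤ s)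
    (ht : 0 ≤ t) : (∫ x in a..t, ‖g x‖ ^ 2) - ∫ x in a..s, ‖g x‖ ^ 2 = ∫ x in s..t, ‖g x‖ ^ 2 :=
  intervalIntegral.integral_interval_sub_left (hu.intervalIntegrable_sq a t ha ht)
    (hu.intervalIntegrable_sq a s ha hs)

/-- Lower semicontinuity of `t ↦ E (u t)` on `[0, ∞)`. -/
lemma exists_forall_lt (hu : IsGradientCurve E C u g) {t : ℝ} (ht : 0 ≤ t) {r : EReal}
    (hr : r < E (u t)) : ∃ δ > 0, ∀ x, 0 ≤ x → |x - t| < δ → r < E (u x) := by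
  have h := (hu.continuousOn t ht).eventually (hu.lsc (u t) r hr)
  obtain ⟨δ, hδ, h⟩ := Metric.mem_nhdsWithin_iff.1 h
  exact ⟨δ, hδ, fun x hx hxt => h ⟨by rwa [Metric.mem_ball, Real.dist_eq], hx⟩⟩

lemma ae_hasDerivAt [CompleteSpace H] (hu : IsGradientCurve E C u g) :
    ∀ᵐ t : ℝ, 0 < t → HasDerivAt u (g t) t := by
  have h : ∀ n : ℕ, ∀ᵐ t : ℝ, t ∈ Ioo (0 : ℝ) n → HasDerivAt u (g t) t := by
    intro n
    filter_upwards [(hu.intervalIntegrable 0 n le_rfl (by positivity)).ae_hasDerivAt_integral]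
      with t ht htn
    have h1 := ht (Ioo_subset_Icc_self.trans Icc_subset_uIcc htn) 0 left_mem_uIcc
    refine (h1.const_add (u 0)).congr_of_eventuallyEq ?_
    filter_upwards [Ioi_mem_nhds htn.1] with x hx
    rw [hu.integral_eq 0 x le_rfl (le_of_lt hx)]
    abel
  filter_upwards [ae_all_iff.2 h] with t ht h0
  obtain ⟨n, hn⟩ := exists_nat_gt t
  exact ht n ⟨h0, hn⟩

/-- The chain rule for `‖u - u c‖²`, in integrated form. -/
lemma integral_inner_sub [CompleteSpace H] (hu : IsGradientCurve E C u g) {c d : ℝ} (hc : 0 ≤ c)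
    (hcd : c ≤ d) :
    IntervalIntegrable (fun x => inner ℝ (g x) (u x - u c)) volume c d ∧
      ∫ x in c..d, inner ℝ (g x) (u x - u c) = ‖u d - u c‖ ^ 2 / 2 := by
  set y : ℝ → ℝ := fun x => ‖u x - u c‖ ^ 2 with hy
  set L : ℝ → ℝ := fun x => ∫ z in c..x, ‖g z‖ with hL
  have hgn := (hu.intervalIntegrable c d hc (hc.trans hcd)).norm
  have hLac : AbsolutelyContinuousOnInterval L c d :=
    hgn.absolutelyContinuousOnInterval_intervalIntegral left_mem_uIcc
  have hLsub : ∀ s ∈ Icc c d, ∀ t ∈ Icc c d, s ≤ t → ‖u t - u s‖ ≤ L t - L s := by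
    intro s hs t ht hst
    rw [hL]
    simp only
    rw [intervalIntegral.integral_interval_sub_left
      (hu.intervalIntegrable c t hc (hc.trans ht.1)).norm
      (hu.intervalIntegrable c s hc (hc.trans hs.1)).norm]
    exact hu.norm_sub_le (hc.trans hs.1) hst
  have hLc : L c = 0 := by simp [hL]
  have hR : ∀ s ∈ Icc c d, ‖u s - u c‖ ≤ L d := by
    intro s hs
    have h1 := hLsub c (left_mem_Icc.2 hcd) s hs hs.1
    have h2 := (norm_nonneg _).trans (hLsub s hs d (right_mem_Icc.2 hcd) hs.2)
    linarith
  have hyac : AbsolutelyContinuousOnInterval y c d := by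
    refine absolutelyContinuousOnInterval_of_dist_le (K := 2 * L d) hLac fun s hs t ht => ?_
    rw [uIcc_of_le hcd] at hs ht
    wlog hst : s ≤ t generalizing s t with hwlog
    · rw [dist_comm (y s), dist_comm (L s)]
      exact hwlog t ht s hs (le_of_not_ge hst)
    have h1 : |‖u t - u c‖ - ‖u s - u c‖| ≤ L t - L s := by
      refine (abs_norm_sub_norm_le _ _).trans ?_
      rw [sub_sub_sub_cancel_right]
      exact hLsub s hs t ht hst
    have h2 := hR s hs
    have h3 := hR t ht
    have h4 : y t - y s = (‖u t - u c‖ + ‖u s - u c‖) * (‖u t - u c‖ - ‖u s - u c‖) := by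
      simp only [hy]; ring
    rw [dist_comm (y s), dist_comm (L s), Real.dist_eq, Real.dist_eq, h4, abs_mul,
      abs_of_nonneg (by positivity : 0 ≤ ‖u t - u c‖ + ‖u s - u c‖)]
    refine mul_le_mul (by linarith) (h1.trans (le_abs_self _)) (abs_nonneg _) ?_
    have := (norm_nonneg _).trans h2
    linarith
  have hderiv : ∀ᵐ x : ℝ, x ∈ uIoc c d → deriv y x = 2 * inner ℝ (g x) (u x - u c) := by
    filter_upwards [hu.ae_hasDerivAt] with x hx hxI
    rw [uIoc_of_le hcd] at hxI
    have h1 := ((hx (hc.trans_lt hxI.1)).sub_const (u c)).norm_sq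
    rw [h1.deriv, real_inner_comm]
  have hderiv' : ∀ᵐ x : ℝ, x ∈ uIoc c d → inner ℝ (g x) (u x - u c) = 2⁻¹ * deriv y x := by
    filter_upwards [hderiv] with x hx hxI
    rw [hx hxI]; ring
  constructor
  · refine (hyac.intervalIntegrable_deriv.const_mul 2⁻¹).congr_ae ?_
    rw [Filter.EventuallyEq, ae_restrict_iff' measurableSet_uIoc]
    filter_upwards [hderiv'] with x hx hxI using (hx hxI).symm
  · rw [intervalIntegral.integral_congr_ae hderiv', intervalIntegral.integral_const_mul,
      hyac.integral_deriv_eq_sub]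
    simp [hy]; ring

end IsGradientCurve

/-! ### The energy along a gradient curve -/

/-- The energy along `u`, as a real function of time, extended to `t < 0` by its value at `0`. -/
noncomputable def energyAlong {H : Type*} (E : H → EReal) (u : ℝ → H) (t : ℝ) : ℝ :=
  (E (u (max t 0))).toReal

lemma energyAlong_of_nonneg {H : Type*} (E : H → EReal) (u : ℝ → H) {t : ℝ} (ht : 0 ≤ t) :
    energyAlong E u t = (E (u t)).toReal := by
  rw [energyAlong, max_eq_left ht]

namespace IsGradientCurve

variable {E : H → EReal} {C : ℝ} {u g : ℝ → H}

/-- The energy decreases along a gradient curve. If it grew at a linear rate between `a` and `b`,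
consider the last time `c` at which it is below the line of that growth: the subgradient inequality
to the right of `c` makes `‖u - u c‖²` decrease from its value zero at `c`. -/
lemma energy_antitone [CompleteSpace H] (hu : IsGradientCurve E C u g) {a b : ℝ} (ha : 0 ≤ a)
    (hab : a ≤ b) : E (u b) ≤ E (u a) := by
  by_contra! hlt
  have hab' : a < b := lt_of_le_of_ne hab (by rintro rfl; exact hlt.false)
  obtain ⟨r, hr1, hr2⟩ := EReal.lt_iff_exists_real_btwn.1 hlt
  have hEa : E (u a) = ((E (u a)).toReal : EReal) :=
    (EReal.coe_toReal (hlt.trans_le le_top).ne (hu.ne_bot _)).symm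
  set α := (E (u a)).toReal
  rw [hEa, EReal.coe_lt_coe_iff] at hr1
  set ε := (r - α) / (b - a) with hε
  have hba : 0 < b - a := sub_pos.2 hab'
  have hε0 : 0 < ε := div_pos (sub_pos.2 hr1) hba
  have hr : r = α + ε * (b - a) := by rw [hε]; field_simp; ring
  set S : Set ℝ := {t | t ∈ Icc a b ∧ E (u t) ≤ ((α + ε * (t - a) : ℝ) : EReal)} with hS
  have haS : a ∈ S := ⟨left_mem_Icc.2 hab, by simp [hEa]⟩
  have hSb : BddAbove S := ⟨b, fun t ht => ht.1.2⟩
  set c := sSup S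
  have hac : a ≤ c := le_csSup hSb haS
  have hcb : c ≤ b := csSup_le ⟨a, haS⟩ fun t ht => ht.1.2
  have hc0 : 0 ≤ c := ha.trans hac
  have hcS : E (u c) ≤ ((α + ε * (c - a) : ℝ) : EReal) := by
    by_contra! hh
    obtain ⟨q, hq1, hq2⟩ := EReal.lt_iff_exists_real_btwn.1 hh
    rw [EReal.coe_lt_coe_iff] at hq1
    obtain ⟨δ, hδ, hδE⟩ := hu.exists_forall_lt hc0 hq2
    obtain ⟨t, htS, htc⟩ := exists_lt_of_lt_csSup ⟨a, haS⟩ (show c - δ < c by linarith)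
    have htc' : t ≤ c := le_csSup hSb htS
    have h1 := hδE t (ha.trans htS.1.1) (by rw [abs_lt]; constructor <;> linarith)
    have h2 := h1.trans_le htS.2
    rw [EReal.coe_lt_coe_iff] at h2
    nlinarith
  have hcb' : c < b := by
    refine lt_of_le_of_ne hcb fun h => ?_
    rw [h, ← hr] at hcS
    exact (hr2.trans_le hcS).false
  have habove : ∀ t, c < t → t ≤ b → ((α + ε * (t - a) : ℝ) : EReal) < E (u t) := by
    intro t hct htb
    by_contra! hh
    exact (notMem_of_csSup_lt hct hSb) ⟨⟨hac.trans hct.le, htb⟩, hh⟩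
  have hEc : E (u c) < ⊤ := hcS.trans_lt (EReal.coe_lt_top _)
  have hEc' : (E (u c)).toReal ≤ α + ε * (c - a) := by
    rw [← EReal.coe_le_coe_iff, EReal.coe_toReal hEc.ne (hu.ne_bot _)]
    exact hcS
  -- Close to `c`, the quadratic error of semiconvexity is dominated by the linear growth.
  have hC := hu.nonneg
  obtain ⟨d, hcd, hdb, hd⟩ : ∃ d, c < d ∧ d ≤ b ∧ C * ∫ x in c..d, ‖g x‖ ^ 2 ≤ ε := by
    have hcont : ContinuousOn (fun t => ∫ x in c..t, ‖g x‖ ^ 2) (uIcc c b) :=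
      intervalIntegral.continuousOn_primitive_interval'
        (hu.intervalIntegrable_sq c b hc0 (hc0.trans hcb)) left_mem_uIcc
    rw [uIcc_of_le hcb] at hcont
    have h1 : Tendsto (fun t => C * ∫ x in c..t, ‖g x‖ ^ 2) (𝓝[>] c) (𝓝 0) := by
      have h2 : Tendsto (fun t => ∫ x in c..t, ‖g x‖ ^ 2) (𝓝[>] c)
          (𝓝 (∫ x in c..c, ‖g x‖ ^ 2)) :=
        (hcont c (left_mem_Icc.2 hcb)).mono_left
          (nhdsWithin_le_of_mem (Icc_mem_nhdsGT hcb'))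
      simpa using h2.const_mul C
    obtain ⟨d, h2, h3⟩ := ((h1.eventually (ge_mem_nhds hε0)).and (Ioc_mem_nhdsGT hcb')).exists
    exact ⟨d, h3.1, h3.2, h2⟩
  obtain ⟨hint, heq⟩ := hu.integral_inner_sub hc0 hcd.le
  have hupper : ∫ x in c..d, inner ℝ (g x) (u x - u c) ≤ ∫ x in c..d, -(ε / 2) * (x - c) := by
    refine intervalIntegral.integral_mono_ae_restrict hcd.le hint
      (by apply Continuous.intervalIntegrable; fun_prop) ?_
    have hne : ∀ᵐ x : ℝ, x ≠ c := by simp [ae_iff, measure_singleton]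
    rw [Filter.EventuallyLE, ae_restrict_iff' measurableSet_Icc]
    filter_upwards [hu.ae_mem, hne] with x hx hxne hxI
    have hcx : c < x := lt_of_le_of_ne hxI.1 hxne.symm
    have hmem := hx (hc0.trans_lt hcx)
    have h1 := hu.le_toReal _ (u c) _ hmem hEc
    have h2 : α + ε * (x - a) < (E (u x)).toReal := by
      rw [← EReal.coe_lt_coe_iff, EReal.coe_toReal hmem.1.ne (hu.ne_bot _)]
      exact habove x hcx (hxI.2.trans hdb)
    have h3 := hu.norm_sub_sq_le hc0 hcx.le
    have h4 : ∫ z in c..x, ‖g z‖ ^ 2 ≤ ∫ z in c..d, ‖g z‖ ^ 2 :=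
      intervalIntegral.integral_mono_interval le_rfl hcx.le hxI.2
        (Eventually.of_forall fun z => sq_nonneg _)
        (hu.intervalIntegrable_sq c d hc0 (hc0.trans hcd.le))
    have h5 : C * ‖u x - u c‖ ^ 2 ≤ (x - c) * ε := by
      calc C * ‖u x - u c‖ ^ 2 ≤ C * ((x - c) * ∫ z in c..x, ‖g z‖ ^ 2) := by gcongr
        _ ≤ C * ((x - c) * ∫ z in c..d, ‖g z‖ ^ 2) := by gcongr
        _ = (x - c) * (C * ∫ z in c..d, ‖g z‖ ^ 2) := by ring
        _ ≤ (x - c) * ε := by gcongr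
    have h6 : inner ℝ (-g x) (u c - u x) = (inner ℝ (g x) (u x - u c) : ℝ) := by
      rw [inner_neg_left, ← inner_neg_right, neg_sub]
    rw [h6, norm_sub_rev] at h1
    linarith
  have hlow : ∫ x in c..d, -(ε / 2) * (x - c) = -(ε / 4) * (d - c) ^ 2 := by
    rw [intervalIntegral.integral_const_mul, intervalIntegral.integral_sub (by simp) (by simp),
      integral_id, intervalIntegral.integral_const, smul_eq_mul]
    ring
  rw [heq, hlow] at hupper
  have : 0 < ε / 4 * (d - c) ^ 2 := by
    have := sub_pos.2 hcd
    positivity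
  nlinarith [sq_nonneg ‖u d - u c‖]

lemma exists_mem_subgradient_norm_sq_le (hu : IsGradientCurve E C u g) {a b : ℝ} (ha : 0 ≤ a)
    (hab : a < b) : ∃ s ∈ Ioo a b, -g s ∈ subgradient E (u s) ∧
      (b - a) * ‖g s‖ ^ 2 ≤ ∫ x in a..b, ‖g x‖ ^ 2 := by
  set μ := volume.restrict (Ioc a b)
  have hμ : μ ≠ 0 := by
    simp only [μ, ne_eq, Measure.restrict_eq_zero, Real.volume_Ioc]
    simpa using hab
  have hN : ∀ᵐ s ∂μ, s ∈ Ioo a b ∧ -g s ∈ subgradient E (u s) := by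
    have hne : ∀ᵐ x : ℝ, x ≠ b := by simp [ae_iff, measure_singleton]
    rw [ae_restrict_iff' measurableSet_Ioc]
    filter_upwards [hu.ae_mem, hne] with s hs hsb hsI
    exact ⟨⟨hsI.1, lt_of_le_of_ne hsI.2 hsb⟩, hs (ha.trans_lt hsI.1)⟩
  obtain ⟨s, hsN, hs⟩ := exists_notMem_null_le_average hμ
    ((intervalIntegrable_iff_integrableOn_Ioc_of_le hab.le).1
      (hu.intervalIntegrable_sq a b ha (ha.trans hab.le))) (ae_iff.1 hN)
  have hs' : s ∈ Ioo a b ∧ -g s ∈ subgradient E (u s) := by simpa [and_assoc] using hsN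
  refine ⟨s, hs'.1, hs'.2, ?_⟩
  have hba : 0 < b - a := sub_pos.2 hab
  rw [setAverage_eq, Real.volume_real_Ioc_of_le hab.le, smul_eq_mul,
    ← intervalIntegral.integral_of_le hab.le, inv_mul_eq_div, le_div_iff₀ hba] at hs
  linarith

lemma energy_lt_top_of_pos [CompleteSpace H] (hu : IsGradientCurve E C u g) {t : ℝ} (ht : 0 < t) :
    E (u t) < ⊤ := by
  obtain ⟨s, hs, hmem, -⟩ := hu.exists_mem_subgradient_norm_sq_le le_rfl ht
  exact (hu.energy_antitone hs.1.le hs.2.le).trans_lt hmem.1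

/-- A backward estimate for the energy over `[t / 2, t]`, which telescopes along `t = 2⁻ⁿ`. The
subgradient inequality is used at a time in `(t / 4, t / 2)` at which `‖g‖²` is at most its
mean. -/
lemma energy_half_le [CompleteSpace H] (hu : IsGradientCurve E C u g) {t : ℝ} (ht : 0 < t)
    (ht1 : t ≤ 1) : (E (u (t / 2))).toReal ≤
      (E (u t)).toReal + (2 + C / 2) * ∫ x in (t / 4)..t, ‖g x‖ ^ 2 := by
  obtain ⟨s, hs, hmem, hsg⟩ := hu.exists_mem_subgradient_norm_sq_le
    (show 0 ≤ t / 4 by linarith) (show t / 4 < t / 2 by linarith)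
  have hs0 : 0 < s := by linarith [hs.1]
  have hst : s ≤ t := by linarith [hs.2]
  set m := ∫ x in (t / 4)..t, ‖g x‖ ^ 2
  have hint := hu.intervalIntegrable_sq (t / 4) t (by linarith) ht.le
  have hnn : ∀ᵐ x : ℝ ∂volume.restrict (Ioc (t / 4) t), 0 ≤ ‖g x‖ ^ 2 :=
    Eventually.of_forall fun x => sq_nonneg _
  have hm1 : ∫ x in (t / 4)..(t / 2), ‖g x‖ ^ 2 ≤ m :=
    intervalIntegral.integral_mono_interval le_rfl (by linarith) (by linarith) hnn hint
  have hm2 : ∫ x in s..t, ‖g x‖ ^ 2 ≤ m :=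
    intervalIntegral.integral_mono_interval hs.1.le hst le_rfl hnn hint
  have hm0 : 0 ≤ m := intervalIntegral.integral_nonneg (by linarith) fun x _ => sq_nonneg _
  have h1 : ‖u t - u s‖ ^ 2 ≤ t * m := by
    refine (hu.norm_sub_sq_le hs0.le hst).trans ?_
    have : 0 ≤ t - s := sub_nonneg.2 hst
    calc _ ≤ (t - s) * m := by gcongr
      _ ≤ t * m := by gcongr; linarith
  have h2 : t / 4 * ‖g s‖ ^ 2 ≤ m := by linarith
  have h3 : ‖g s‖ * ‖u t - u s‖ ≤ 2 * m := by
    refine le_of_abs_le (abs_le_of_sq_le_sq ?_ (by positivity))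
    calc (‖g s‖ * ‖u t - u s‖) ^ 2 = ‖g s‖ ^ 2 * ‖u t - u s‖ ^ 2 := by ring
      _ ≤ ‖g s‖ ^ 2 * (t * m) := by gcongr
      _ = 4 * (t / 4 * ‖g s‖ ^ 2) * m := by ring
      _ ≤ 4 * m * m := by gcongr
      _ = (2 * m) ^ 2 := by ring
  have h4 := hu.le_toReal _ (u t) _ hmem (hu.energy_lt_top_of_pos ht)
  have h5 : -(2 * m) ≤ inner ℝ (-g s) (u t - u s) := by
    have := neg_le_of_abs_le (abs_real_inner_le_norm (-g s) (u t - u s))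
    rw [norm_neg] at this
    linarith
  have h6 : (E (u (t / 2))).toReal ≤ (E (u s)).toReal :=
    EReal.toReal_le_toReal (hu.energy_antitone hs0.le hs.2.le) (hu.ne_bot _) hmem.1.ne
  have h7 : C / 2 * ‖u t - u s‖ ^ 2 ≤ C / 2 * m := by
    have := hu.nonneg
    have h8 : t * m ≤ m := mul_le_of_le_one_left hm0 ht1
    gcongr
    linarith
  linarith

lemma energy_lt_top [CompleteSpace H] (hu : IsGradientCurve E C u g) {t : ℝ} (ht : 0 ≤ t) :
    E (u t) < ⊤ := by
  rcases ht.eq_or_lt' with rfl | h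
  swap
  · exact hu.energy_lt_top_of_pos h
  set K := 2 + C / 2
  set M : ℝ → ℝ := fun t => ∫ x in (0 : ℝ)..t, ‖g x‖ ^ 2 with hM
  have hM0 : ∀ t, 0 ≤ t → 0 ≤ M t := fun t ht =>
    intervalIntegral.integral_nonneg ht fun x _ => sq_nonneg _
  have hK : 0 ≤ K := by have := hu.nonneg; positivity
  have hbound : ∀ n : ℕ, (E (u ((1 / 2) ^ n))).toReal +
      K * (M ((1 / 2) ^ n) + M ((1 / 2) ^ n / 2)) ≤ (E (u 1)).toReal + K * (M 1 + M (1 / 2)) := by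
    intro n
    induction n with
    | zero => simp
    | succ n ih =>
      refine le_trans ?_ ih
      have hpos : (0 : ℝ) < (1 / 2) ^ n := by positivity
      have h1 := hu.energy_half_le hpos (pow_le_one₀ (by norm_num) (by norm_num))
      have h2 := hu.integral_sq_sub le_rfl (by positivity : (0 : ℝ) ≤ (1 / 2) ^ n / 4) hpos.le
      have h3 : (1 / 2 : ℝ) ^ (n + 1) = (1 / 2) ^ n / 2 := by rw [pow_succ]; ring
      have h4 : (1 / 2 : ℝ) ^ n / 2 / 2 = (1 / 2) ^ n / 4 := by ring
      rw [h3, h4]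
      rw [← h2] at h1
      change _ ≤ _ + K * (M _ - M _) at h1
      linarith
  refine lt_of_not_ge fun htop => ?_
  rw [top_le_iff] at htop
  set B := (E (u 1)).toReal + K * (M 1 + M (1 / 2))
  obtain ⟨δ, hδ, hE⟩ := hu.exists_forall_lt le_rfl
    (show (B : EReal) < E (u 0) by rw [htop]; exact EReal.coe_lt_top _)
  obtain ⟨n, hn⟩ := exists_pow_lt_of_lt_one hδ (by norm_num : (1 / 2 : ℝ) < 1)
  have hpos : (0 : ℝ) < (1 / 2) ^ n := by positivity
  have h1 := hE _ hpos.le (by rwa [sub_zero, abs_of_pos hpos])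
  have h2 := hbound n
  rw [← EReal.coe_toReal (hu.energy_lt_top_of_pos hpos).ne (hu.ne_bot _),
    EReal.coe_lt_coe_iff] at h1
  have h3 := hM0 _ hpos.le
  have h4 := hM0 ((1 / 2) ^ n / 2) (by positivity)
  have h5 : 0 ≤ K * (M ((1 / 2) ^ n) + M ((1 / 2) ^ n / 2)) := by positivity
  linarith

lemma antitone_energyAlong [CompleteSpace H] (hu : IsGradientCurve E C u g) :
    Antitone (energyAlong E u) := fun _ _ hst =>
  EReal.toReal_le_toReal (hu.energy_antitone (le_max_right _ _) (max_le_max_right 0 hst))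
    (hu.ne_bot _) (hu.energy_lt_top (le_max_right _ _)).ne

/-- The chain rule for the energy: every subgradient at `u t` computes the derivative. -/
lemma deriv_energyAlong [CompleteSpace H] (hu : IsGradientCurve E C u g) {t : ℝ} (ht : 0 < t)
    (hd : DifferentiableAt ℝ (energyAlong E u) t) (hut : HasDerivAt u (g t) t) {f : H}
    (hf : f ∈ subgradient E (u t)) : deriv (energyAlong E u) t = inner ℝ f (g t) := by
  have hmin : IsLocalMin (fun x => energyAlong E u x - inner ℝ f (u x) +
      C / 2 * ‖u x - u t‖ ^ 2) t := by
    filter_upwards [Ioi_mem_nhds ht] with x hx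
    rw [mem_Ioi] at hx
    have h := hu.le_toReal _ (u x) _ hf (hu.energy_lt_top hx.le)
    rw [energyAlong_of_nonneg E u hx.le, energyAlong_of_nonneg E u ht.le]
    rw [inner_sub_right] at h
    simp
    linarith
  have h1 : HasDerivAt (fun x => energyAlong E u x - inner ℝ f (u x) +
      C / 2 * ‖u x - u t‖ ^ 2) (deriv (energyAlong E u) t - inner ℝ f (g t)) t := by
    have h2 := (hut.sub_const (u t)).norm_sq
    have h3 : HasDerivAt (fun x => (inner ℝ f (u x) : ℝ)) (inner ℝ f (g t)) t := by
      simpa using (hasDerivAt_const t f).inner ℝ hut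
    refine ((hd.hasDerivAt.sub h3).add (h2.const_mul (C / 2))).congr_deriv ?_
    simp
  have := hmin.hasDerivAt_eq_zero h1
  linarith

lemma ae_deriv_energyAlong [CompleteSpace H] (hu : IsGradientCurve E C u g) :
    ∀ᵐ t : ℝ, 0 < t → deriv (energyAlong E u) t = -‖g t‖ ^ 2 := by
  have hdiff : ∀ᵐ t, DifferentiableAt ℝ (energyAlong E u) t := by
    filter_upwards [hu.antitone_energyAlong.neg.ae_differentiableAt] with t ht
    simpa using ht.neg
  filter_upwards [hu.ae_mem, hu.ae_hasDerivAt, hdiff] with t h1 h2 h3 ht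
  rw [hu.deriv_energyAlong ht h3 (h2 ht) (h1 ht), inner_neg_left, real_inner_self_eq_norm_sq]

lemma integral_norm_sq_le [CompleteSpace H] (hu : IsGradientCurve E C u g) {s t : ℝ} (hs : 0 ≤ s)
    (hst : s ≤ t) : ∫ x in s..t, ‖g x‖ ^ 2 ≤ energyAlong E u s - energyAlong E u t := by
  refine le_trans (le_of_eq ?_)
    (intervalIntegral_neg_deriv_le_of_antitone hu.antitone_energyAlong hst).2
  refine intervalIntegral.integral_congr_ae ?_
  filter_upwards [hu.ae_deriv_energyAlong] with x hx hxI
  rw [uIoc_of_le hst] at hxI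
  rw [hx (hs.trans_lt hxI.1), neg_neg]

end IsGradientCurve

/-! ### Length and convergence -/

namespace IsGradientCurve

variable {E : H → EReal} {C : ℝ} {u g : ℝ → H}

lemma toReal_le_energyAlong [CompleteSpace H] (hu : IsGradientCurve E C u g) {φ : H}
    (hφ : φ ∈ omegaLimitSet u)
    {t : ℝ} (ht : 0 ≤ t) : (E φ).toReal ≤ energyAlong E u t := by
  obtain ⟨τ, -, -, hτ, hτφ⟩ := hφ
  rw [energyAlong_of_nonneg E u ht]
  refine EReal.toReal_le_toReal ?_ (hu.ne_bot _) (hu.energy_lt_top ht).ne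
  by_contra! hlt
  obtain ⟨n, hn1, hn2⟩ := ((hτφ.eventually (hu.lsc φ _ hlt)).and
    (hτ.eventually (eventually_ge_atTop t))).exists
  exact (hn1.trans_le (hu.energy_antitone ht hn2)).false

/-- The energy decreases to its value at a point of the `ω`-limit set: since `‖g‖²` has small mass
on late unit intervals, there are late times at which `u` is close to the point and the subgradient
`-g` is small, so that the subgradient inequality bounds the energy from above. -/
lemma exists_energyAlong_lt [CompleteSpace H] (hu : IsGradientCurve E C u g) {φ : H}
    (hφ : φ ∈ omegaLimitSet u)
    (hEφ : E φ < ⊤) {ε : ℝ} (hε : 0 < ε) : ∃ t, 0 ≤ t ∧ energyAlong E u t < (E φ).toReal + ε := by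
  by_contra! hge
  have hanti := hu.antitone_energyAlong
  have hbdd : BddBelow (range (energyAlong E u)) := by
    refine ⟨(E φ).toReal, ?_⟩
    rintro _ ⟨t, rfl⟩
    exact (hu.toReal_le_energyAlong hφ (le_max_right t 0)).trans (hanti (le_max_left t 0))
  have hC := hu.nonneg
  set ρ := √(ε / (2 * (2 + 2 * C))) with hρ
  have hρ0 : 0 < ρ := Real.sqrt_pos.2 (by positivity)
  have hρε : (2 + 2 * C) * ρ ^ 2 < ε := by
    rw [hρ, Real.sq_sqrt (by positivity)]
    have : (2 + 2 * C) * (ε / (2 * (2 + 2 * C))) = ε / 2 := by field_simp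
    linarith
  have hlim := tendsto_atTop_ciInf hanti hbdd
  have hdiff : Tendsto (fun t => energyAlong E u t - energyAlong E u (t + 1)) atTop (𝓝 0) := by
    simpa using hlim.sub (hlim.comp (tendsto_atTop_add_const_right atTop 1 tendsto_id))
  have hφ' := hφ
  obtain ⟨τ, hτ0, -, hτ, hτφ⟩ := hφ'
  obtain ⟨n, hn1, hn2⟩ := ((hτ.eventually (hdiff.eventually (gt_mem_nhds (pow_pos hρ0 2)))).and
    (hτφ.eventually (Metric.ball_mem_nhds φ hρ0))).exists
  rw [dist_eq_norm] at hn2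
  set a := τ n
  have ha : 0 ≤ a := hτ0 n
  have hI := (hu.integral_norm_sq_le ha (by linarith : a ≤ a + 1)).trans hn1.le
  obtain ⟨s, hs, hmem, hsg⟩ := hu.exists_mem_subgradient_norm_sq_le ha (by linarith : a < a + 1)
  have hs0 : 0 ≤ s := ha.trans hs.1.le
  have h1 : ‖g s‖ ≤ ρ := by
    refine le_of_abs_le (abs_le_of_sq_le_sq ?_ hρ0.le)
    linarith
  have h2 : ‖u s - u a‖ ≤ ρ := by
    refine le_of_abs_le (abs_le_of_sq_le_sq ?_ hρ0.le)
    have h3 : ∫ x in a..s, ‖g x‖ ^ 2 ≤ ∫ x in a..(a + 1), ‖g x‖ ^ 2 :=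
      intervalIntegral.integral_mono_interval le_rfl hs.1.le hs.2.le
        (Eventually.of_forall fun x => sq_nonneg _)
        (hu.intervalIntegrable_sq a (a + 1) ha (by linarith))
    have h4 : 0 ≤ ∫ x in a..s, ‖g x‖ ^ 2 :=
      intervalIntegral.integral_nonneg hs.1.le fun x _ => sq_nonneg _
    have h5 := hu.norm_sub_sq_le ha hs.1.le
    have h6 : (s - a) * ∫ x in a..s, ‖g x‖ ^ 2 ≤ ∫ x in a..s, ‖g x‖ ^ 2 :=
      mul_le_of_le_one_left h4 (by linarith [hs.2])
    linarith
  have h3 : ‖φ - u s‖ ≤ 2 * ρ := by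
    have h4 : φ - u s = -((u s - u a) + (u a - φ)) := by abel
    rw [h4, norm_neg]
    linarith [norm_add_le (u s - u a) (u a - φ)]
  have h4 := hu.le_toReal _ φ _ hmem hEφ
  have h5 : -(ρ * (2 * ρ)) ≤ inner ℝ (-g s) (φ - u s) := by
    have h6 := neg_le_of_abs_le (abs_real_inner_le_norm (-g s) (φ - u s))
    rw [norm_neg] at h6
    have h7 : ‖g s‖ * ‖φ - u s‖ ≤ ρ * (2 * ρ) := by gcongr
    linarith
  have h6 : C / 2 * ‖φ - u s‖ ^ 2 ≤ C / 2 * (2 * ρ) ^ 2 := by gcongr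
  have h7 := hge s hs0
  rw [energyAlong_of_nonneg E u hs0] at h7
  nlinarith

/-- The Kurdyka–Łojasiewicz–Simon inequality bounds the speed of `u` by the rate of decrease of
`Θ (E (u t))`. The chain rule for `Θ (E (u t))` may fail only when `E (u t)` is in the null set
where `Θ` is not differentiable, and for almost every such `t` the speed is zero. -/
lemma integral_norm_le [CompleteSpace H] (hu : IsGradientCurve E C u g) {Θ : ℝ → ℝ}
    (hΘ : Monotone Θ) {a b : ℝ} (ha : 0 ≤ a) (hab : a ≤ b)
    (hKLS : ∀ t ∈ Ioo a b, (0 : H) ∉ subgradient E (u t) → 1 ≤ slope (compEnergy Θ E) (u t)) :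
    ∫ x in a..b, ‖g x‖ ≤ Θ (energyAlong E u a) - Θ (energyAlong E u b) := by
  have hanti := hu.antitone_energyAlong
  have hcomp : Antitone fun t => Θ (energyAlong E u t) := fun _ _ hst => hΘ (hanti hst)
  obtain ⟨hint, hle⟩ := intervalIntegral_neg_deriv_le_of_antitone hcomp hab
  refine le_trans ?_ hle
  refine intervalIntegral.integral_mono_ae_restrict hab
    (hu.intervalIntegrable a b ha (ha.trans hab)).norm hint ?_
  have hne : ∀ᵐ x : ℝ, x ≠ a ∧ x ≠ b := by
    have (c : ℝ) : ∀ᵐ x : ℝ, x ≠ c := by simp [ae_iff, measure_singleton]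
    exact (this a).and (this b)
  have hnull := ae_deriv_eq_zero_of_antitone hanti (ae_iff.1 hΘ.ae_differentiableAt)
  rw [Filter.EventuallyLE, ae_restrict_iff' measurableSet_Icc]
  filter_upwards [hne, hnull, hu.ae_mem, hu.ae_hasDerivAt, hu.ae_deriv_energyAlong]
    with t htab hN hmem hut hde htI
  have hat : a < t := lt_of_le_of_ne htI.1 htab.1.symm
  have ht : 0 < t := ha.trans_lt hat
  have htb : t < b := lt_of_le_of_ne htI.2 htab.2
  rcases eq_or_ne (g t) 0 with hg | hg
  · rw [hg, norm_zero]
    have : 0 ≤ deriv (fun x => -Θ (energyAlong E u x)) t := hcomp.neg.deriv_nonneg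
    rwa [deriv.fun_neg] at this
  · have hgpos : 0 < ‖g t‖ := norm_pos_iff.2 hg
    have hd0 : deriv (energyAlong E u) t ≠ 0 := by
      rw [hde ht]
      exact neg_ne_zero.2 (pow_pos hgpos 2).ne'
    have hdiff : DifferentiableAt ℝ (energyAlong E u) t := differentiableAt_of_deriv_ne_zero hd0
    have hΘd : DifferentiableAt ℝ Θ (energyAlong E u t) := by
      by_contra hh
      exact hd0 (hN hh)
    have h0 : (0 : H) ∉ subgradient E (u t) := fun hh => hd0 <| by
      rw [hu.deriv_energyAlong ht hdiff (hut ht) hh, inner_zero_left]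
    have hder := hΘd.hasDerivAt
    have hone : 1 ≤ deriv Θ (energyAlong E u t) * ‖-g t‖ :=
      one_le_mul_norm_of_one_le_slope hu.ne_bot hΘ (hmem ht)
        (energyAlong_of_nonneg E u ht.le ▸ hder) (hKLS t ⟨hat, htb⟩ h0)
    have hchain : deriv (fun x => Θ (energyAlong E u x)) t =
        deriv Θ (energyAlong E u t) * deriv (energyAlong E u) t :=
      (hder.comp t hdiff.hasDerivAt).deriv
    rw [hchain, hde ht]
    rw [norm_neg] at hone
    nlinarith

/-- Close to `φ` in position and in energy, the curve cannot leave a ball on which the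
Kurdyka–Łojasiewicz–Simon inequality holds, because its remaining length is smaller than its
distance to the boundary. -/
lemma exists_forall_norm_sub_lt [CompleteSpace H] (hu : IsGradientCurve E C u g) {φ : H}
    (hφ : φ ∈ omegaLimitSet u) (hEφ : E φ < ⊤) {Θ : ℝ → ℝ} (hΘ : Monotone Θ)
    (hΘc : ContinuousAt Θ (E φ).toReal) {δ : ℝ} (hδ : 0 < δ)
    (hKLS : ∀ v, E v < ⊤ → ‖v - φ‖ < δ → |(E v).toReal - (E φ).toReal| < δ →
      (0 : H) ∉ subgradient E v → 1 ≤ slope (compEnergy Θ E) v)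
    {r : ℝ} (hr : 0 < r) (hrδ : r ≤ δ) :
    ∃ T, 0 ≤ T ∧ (∀ t, T ≤ t → ‖u t - φ‖ < r) ∧ ∀ t, T ≤ t → ∫ x in T..t, ‖g x‖ ≤ r := by
  have hanti := hu.antitone_energyAlong
  have hlow : ∀ t, 0 ≤ t → (E φ).toReal ≤ energyAlong E u t :=
    fun t ht => hu.toReal_le_energyAlong hφ ht
  obtain ⟨η, hη, hηΘ⟩ := Metric.continuousAt_iff.1 hΘc (r / 2) (half_pos hr)
  obtain ⟨t₀, ht₀, ht₀E⟩ := hu.exists_energyAlong_lt hφ hEφ (lt_min hδ hη)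
  have hφ' := hφ
  obtain ⟨τ, hτ0, -, hτ, hτφ⟩ := hφ'
  obtain ⟨n, hn1, hn2⟩ := ((hτ.eventually (eventually_ge_atTop t₀)).and
    (hτφ.eventually (Metric.ball_mem_nhds φ (half_pos hr)))).exists
  set T := τ n
  have hT : 0 ≤ T := hτ0 n
  rw [dist_eq_norm] at hn2
  have hET : energyAlong E u T < (E φ).toReal + min δ η := (hanti hn1).trans_lt ht₀E
  have hΘT : Θ (energyAlong E u T) - Θ (E φ).toReal < r / 2 := by
    have h1 := hηΘ (x := energyAlong E u T) (by
      rw [Real.dist_eq, abs_of_nonneg (sub_nonneg.2 (hlow T hT))]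
      linarith [min_le_right δ η])
    rw [Real.dist_eq] at h1
    exact (le_abs_self _).trans_lt h1
  have hlen : ∀ t, T ≤ t → (∀ s ∈ Ioo T t, ‖u s - φ‖ < r) → ∫ x in T..t, ‖g x‖ < r / 2 := by
    intro t hTt hs
    refine (hu.integral_norm_le hΘ hT hTt fun s hsI => ?_).trans_lt ?_
    · have hs0 : 0 ≤ s := hT.trans hsI.1.le
      refine hKLS (u s) (hu.energy_lt_top hs0) ((hs s hsI).trans_le hrδ) ?_
      rw [← energyAlong_of_nonneg E u hs0, abs_of_nonneg (sub_nonneg.2 (hlow s hs0))]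
      linarith [hanti hsI.1.le, min_le_left δ η]
    · linarith [hΘ (hlow t (hT.trans hTt))]
  have hstay : ∀ t, T ≤ t → ‖u t - φ‖ < r := by
    by_contra! hex
    obtain ⟨t₁, ht₁, ht₁r⟩ := hex
    -- The first exit time from the ball.
    set S : Set ℝ := Ici T ∩ (fun t => ‖u t - φ‖) ⁻¹' Ici r with hS
    have hScl : IsClosed S := by
      have hc : ContinuousOn (fun t => ‖u t - φ‖) (Ici T) :=
        ((hu.continuousOn.mono (Ici_subset_Ici.2 hT)).sub continuousOn_const).norm
      exact hc.preimage_isClosed_of_isClosed isClosed_Ici isClosed_Ici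
    have hSb : BddBelow S := ⟨T, fun t ht => ht.1⟩
    obtain ⟨hTs, hsr⟩ := hScl.csInf_mem ⟨t₁, ht₁, ht₁r⟩ hSb
    set t := sInf S
    rw [mem_Ici] at hTs
    rw [mem_preimage, mem_Ici] at hsr
    have h1 := hlen t hTs fun s hs => by
      by_contra! hh
      exact (csInf_le hSb ⟨hs.1.le, hh⟩).not_gt hs.2
    have h2 := hu.norm_sub_le hT hTs
    have h3 : ‖u t - φ‖ ≤ ‖u t - u T‖ + ‖u T - φ‖ := norm_sub_le_norm_sub_add_norm_sub _ _ _
    linarith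
  exact ⟨T, hT, hstay, fun t ht =>
    (hlen t ht fun s hs => hstay s hs.1.le).le.trans (half_le_self hr.le)⟩

lemma hasFiniteLength (hu : IsGradientCurve E C u g) {B : ℝ}
    (hB : ∀ t, 0 ≤ t → ∫ x in (0 : ℝ)..t, ‖g x‖ ≤ B) : HasFiniteLength u := by
  refine lt_of_le_of_lt ?_ (ENNReal.ofReal_lt_top (r := B))
  set L : ℝ → ℝ := fun t => ∫ x in (0 : ℝ)..t, ‖g x‖
  refine iSup_le fun p => ?_
  obtain ⟨n, τ, hτ, hτ0⟩ := p
  calc ∑ i ∈ Finset.range n, edist (u (τ (i + 1))) (u (τ i))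
      ≤ ∑ i ∈ Finset.range n, ENNReal.ofReal (L (τ (i + 1)) - L (τ i)) := by
        refine Finset.sum_le_sum fun i _ => ?_
        rw [edist_dist, dist_eq_norm]
        refine ENNReal.ofReal_le_ofReal ?_
        refine (hu.norm_sub_le (hτ0 i) (hτ i.le_succ)).trans_eq ?_
        exact (intervalIntegral.integral_interval_sub_left
          (hu.intervalIntegrable _ _ le_rfl (hτ0 (i + 1))).norm
          (hu.intervalIntegrable _ _ le_rfl (hτ0 i)).norm).symm
    _ = ENNReal.ofReal (L (τ n) - L (τ 0)) := by
        rw [← ENNReal.ofReal_sum_of_nonneg, Finset.sum_range_sub (fun i => L (τ i))]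
        intro i _
        have := (norm_nonneg _).trans (hu.norm_sub_le (hτ0 i) (hτ i.le_succ))
        rwa [← intervalIntegral.integral_interval_sub_left
          (hu.intervalIntegrable 0 _ le_rfl (hτ0 (i + 1))).norm
          (hu.intervalIntegrable 0 _ le_rfl (hτ0 i)).norm] at this
    _ ≤ ENNReal.ofReal B := by
        refine ENNReal.ofReal_le_ofReal ?_
        have h0 : 0 ≤ L (τ 0) :=
          intervalIntegral.integral_nonneg (hτ0 0) fun x _ => norm_nonneg _
        linarith [hB (τ n) (hτ0 n)]

end IsGradientCurve

lemma MemL2loc.intervalIntegrable {F : Type*} [NormedAddCommGroup F] {g : ℝ → F}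
    (hg : MemL2loc g) {s t : ℝ} (hs : 0 ≤ s) (ht : 0 ≤ t) :
    IntervalIntegrable g volume s t ∧ IntervalIntegrable (fun x => ‖g x‖ ^ 2) volume s t := by
  set R := max s t + 1
  have hR : 0 < R := by linarith [le_max_left s t]
  have hsub : uIoc s t ⊆ Ioo 0 R := fun x hx =>
    ⟨(le_min hs ht).trans_lt hx.1, hx.2.trans_lt (lt_add_one _)⟩
  have h := hg R hR
  rw [intervalIntegrable_iff, intervalIntegrable_iff]
  exact ⟨IntegrableOn.mono_set (h.integrable (by norm_num)) hsub,
    IntegrableOn.mono_set (MemLp.integrable_norm_pow h two_ne_zero) hsub⟩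

lemma IsGlobalStrongSolution.exists_isGradientCurve [CompleteSpace H] {E : H → EReal}
    (hproper : Proper E)
    (hsemi : Semiconvex E) (hlsc : LowerSemicontinuous E) {u : ℝ → H}
    (hu : IsGlobalStrongSolution E u) : ∃ C g, IsGradientCurve E C u g := by
  obtain ⟨w, hw⟩ := hsemi
  obtain ⟨hcont, -, g, hg, hweak, hmem⟩ := hu
  have hint : ∀ s t, 0 ≤ s → 0 ≤ t → IntervalIntegrable g volume s t := fun s t hs ht =>
    (hg.intervalIntegrable hs ht).1
  have hpos : ∀ s t, 0 < s → s ≤ t → ∫ x in s..t, g x = u t - u s := by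
    intro s t hs hst
    rcases hst.eq_or_lt with rfl | hlt
    · simp
    exact hweak.integral_eq_sub measurableSet_Ioi hlt (fun x hx => hs.trans_le hx.1)
      (hcont.continuousAt (Ici_mem_nhds hs)) (hcont.continuousAt (Ici_mem_nhds (hs.trans hlt)))
  refine ⟨max w 0, g, hproper.1, hlsc, le_max_right _ _, fun v z f hf hz => ?_, hcont, hint,
    fun s t hs ht => (hg.intervalIntegrable hs ht).2, fun s t hs hst => ?_, ?_⟩
  · refine le_trans ?_ (toReal_add_inner_le_of_mem_subgradient hproper.1 hw hf hz)
    gcongr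
    exact le_max_left _ _
  · rcases hs.eq_or_lt' with rfl | hs0
    swap
    · exact hpos s t hs0 hst
    rcases hst.eq_or_lt with rfl | ht
    · simp
    -- The case `s = 0` follows by continuity of both sides.
    have h1 : Tendsto (fun s => u t - u s) (𝓝[>] 0) (𝓝 (u t - u 0)) :=
      tendsto_const_nhds.sub ((hcont 0 self_mem_Ici).mono_left
        (nhdsWithin_mono _ Ioi_subset_Ici_self))
    have h2 : Tendsto (fun s => ∫ x in s..t, g x) (𝓝[>] 0) (𝓝 (∫ x in (0 : ℝ)..t, g x)) := by
      have hc := intervalIntegral.continuousOn_primitive_interval' (hint 0 t le_rfl ht.le)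
        (right_mem_uIcc)
      rw [uIcc_of_le ht.le] at hc
      have h3 := ((hc 0 (left_mem_Icc.2 ht.le)).mono_left
        (nhdsWithin_le_of_mem (Icc_mem_nhdsGT ht))).neg
      simpa only [← intervalIntegral.integral_symm] using h3
    refine tendsto_nhds_unique h2 (h1.congr' ?_)
    filter_upwards [Ioo_mem_nhdsGT ht] with s hs
    exact (hpos s t hs.1 hs.2.le).symm
  · exact (ae_restrict_iff' measurableSet_Ioi).1 hmem

lemma nhds_dom {H : Type*} [NormedAddCommGroup H] {E : H → EReal} (φ : Dom E) :
    𝓝 φ = comap Dom.incl (𝓝 φ.incl) ⊓ comap Dom.energy (𝓝 φ.energy) := by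
  rw [← nhds_induced, ← nhds_induced]
  exact @nhds_inf _ (TopologicalSpace.induced Dom.incl inferInstance)
    (TopologicalSpace.induced Dom.energy inferInstance) φ

/-- A `τ_E`-neighbourhood contains the points close to its centre in position and in energy. -/
lemma exists_pos_forall_mem_of_mem_nhds {H : Type*} [NormedAddCommGroup H] {E : H → EReal}
    {φ : Dom E} {U : Set (Dom E)} (hU : U ∈ 𝓝 φ) : ∃ δ > 0, ∀ v : Dom E, ‖v.incl - φ.incl‖ < δ →
      |v.energy - φ.energy| < δ → v ∈ U := by
  rw [nhds_dom, mem_inf_iff] at hU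
  obtain ⟨V, ⟨V', hV', hV⟩, W, ⟨W', hW', hW⟩, rfl⟩ := hU
  obtain ⟨δ₁, h1, hδ₁⟩ := Metric.mem_nhds_iff.1 hV'
  obtain ⟨δ₂, h2, hδ₂⟩ := Metric.mem_nhds_iff.1 hW'
  refine ⟨min δ₁ δ₂, lt_min h1 h2, fun v hv hv' => ⟨hV (hδ₁ ?_), hW (hδ₂ ?_)⟩⟩
  · rw [Metric.mem_ball, dist_eq_norm]
    exact hv.trans_le (min_le_left _ _)
  · rw [Metric.mem_ball, Real.dist_eq]
    exact hv'.trans_le (min_le_right _ _)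

end GradSys

theorem theorem3p4 {H : Type*} [NormedAddCommGroup H] [InnerProductSpace ℝ H] [CompleteSpace H]
    (E : H → EReal) (hproper : GradSys.Proper E) (hsemi : GradSys.Semiconvex E)
    (hlsc : LowerSemicontinuous E)
    (u : ℝ → H) (hu : GradSys.IsGlobalStrongSolution E u)
    (φ : GradSys.Dom E) (hφ : φ.incl ∈ GradSys.omegaLimitSet u)
    (U : Set (GradSys.Dom E)) (hU : U ∈ 𝓝 φ) (hKLS : GradSys.KLS E (GradSys.Dom.incl '' U)) :
    GradSys.HasFiniteLength u ∧
      ∃ hdom : ∀ t : ℝ≥0, E (u t) < ⊤,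
        Tendsto (fun t : ℝ≥0 => GradSys.Dom.mk (u t) (hdom t)) atTop (𝓝 φ) := by
  obtain ⟨C, g, hg⟩ := hu.exists_isGradientCurve hproper hsemi hlsc
  obtain ⟨Θ, hΘmono, hΘ, hslope⟩ := hKLS
  obtain ⟨δ, hδ, hδU⟩ := GradSys.exists_pos_forall_mem_of_mem_nhds hU
  have hEφ : E φ.incl < ⊤ := φ.2
  have htrap := fun {r : ℝ} => hg.exists_forall_norm_sub_lt hφ hEφ hΘmono.monotone
    (GradSys.continuous_of_monotone_of_memW11loc hΘmono.monotone hΘ).continuousAt hδ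
    (fun v hv h1 h2 => hslope v ⟨GradSys.Dom.mk v hv, hδU (GradSys.Dom.mk v hv) h1 h2, rfl⟩)
    (r := r)
  have hdom : ∀ t : ℝ≥0, E (u t) < ⊤ := fun t => hg.energy_lt_top t.coe_nonneg
  refine ⟨?_, hdom, ?_⟩
  · obtain ⟨T, hT, -, hTlen⟩ := htrap hδ le_rfl
    refine hg.hasFiniteLength (B := (∫ x in (0 : ℝ)..T, ‖g x‖) + δ) fun t ht => ?_
    have h1 : ∫ x in (0 : ℝ)..t, ‖g x‖ ≤ ∫ x in (0 : ℝ)..max t T, ‖g x‖ :=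
      intervalIntegral.integral_mono_interval le_rfl ht (le_max_left t T)
        (Eventually.of_forall fun x => norm_nonneg _)
        (hg.intervalIntegrable 0 _ le_rfl (ht.trans (le_max_left t T))).norm
    have h2 := hTlen (max t T) (le_max_right t T)
    have h3 := intervalIntegral.integral_add_adjacent_intervals
      (hg.intervalIntegrable 0 T le_rfl hT).norm
      (hg.intervalIntegrable T (max t T) hT (hT.trans (le_max_right t T))).norm
    linarith
  · rw [GradSys.nhds_dom, tendsto_inf, tendsto_comap_iff, tendsto_comap_iff]
    constructor
    · rw [Metric.tendsto_atTop]
      intro r hr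
      obtain ⟨T, hT, hTr, -⟩ := htrap (lt_min hr hδ) (min_le_right r δ)
      refine ⟨⟨T, hT⟩, fun t ht => ?_⟩
      rw [dist_eq_norm]
      exact (hTr t ht).trans_le (min_le_left r δ)
    · rw [Metric.tendsto_atTop]
      intro r hr
      obtain ⟨T, hT, hTE⟩ := hg.exists_energyAlong_lt hφ hEφ hr
      refine ⟨⟨T, hT⟩, fun t ht => ?_⟩
      have h1 := hg.toReal_le_energyAlong hφ t.coe_nonneg
      have h2 := hg.antitone_energyAlong (show T ≤ (t : ℝ) from ht)
      have h3 : (GradSys.Dom.mk (u t) (hdom t)).energy = GradSys.energyAlong E u t :=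
        (GradSys.energyAlong_of_nonneg E u t.coe_nonneg).symm
      have h4 : φ.energy = (E φ.incl).toReal := rfl
      rw [Function.comp_apply, h3, h4, Real.dist_eq, abs_of_nonneg (sub_nonneg.2 h1)]
      linarith
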